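/- For a permutation $\sigma=\sigma_1\cdots\sigma_n$ of $[n]=\{1,\dots,n\}$ ($n\ge 0$), call $\sigma$ simsun if for every $k$ the subword of $\sigma$ consisting of the letters in $\{1,\dots,k\}$ (in the order in which they appear in $\sigma$) has no three consecutive decreasing entries, and double simsun if both $\sigma$ and $\sigma^{-1}$ are simsun. For a permutation $\omega$ of $[t]$, let $\mathcal{DRS}_n(\omega)$ be the set of double simsun permutations $\sigma$ of $[n]$ that avoid $\omega$, i.e. for which there are no indices $i_1<\cdots<i_t$ such that $\sigma_{i_j}<\sigma_{i_k}$ if and only if $\omega_j<\omega_k$ for all $j,k$. Let $S_n$ denote the secondary structure number, indexed so that $(S_n)_{n\ge0}=(1,1,2,4,8,17,37,\dots)$; that is, $S_n=a_{n+1}$, where $a_0=1$ and $a_{m+1}=a_m+\sum_{k=1}^{m-1}a_k a_{m-1-k}$ for $m\ge0$. Theorem. For every $n\ge0$, $$|\mathcal{DRS}_n(132)|=S_n,$$ and $S_n$ is also the number of Motzkin paths of length $n$ (lattice paths from $(0,0)$ to $(n,0)$ with steps $(1,1)$, $(1,-1)$, $(1,0)$ that never pass below the $x$-axis) without two consecutive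 up steps. Moreover, the map $\Gamma$ on permutations of $[n]$ given by $\Gamma(\sigma)_i=n+1-\sigma^{-1}_{n+1-i}$ is an involution, and it restricts to a bijection from $\mathcal{DRS}_n(132)$ onto $\mathcal{DRS}_n(213)$. -/

import Mathlib

namespace Simsun

/-- A word has no double descent: no three consecutive entries are decreasing. -/
def NoDoubleDescent (w : List ℕ) : Prop :=
  ∀ a b c : ℕ, a > b → b > c → ¬ [a, b, c] <:+: w

/-- The one-line word `σ₁ ⋯ σₙ` of a permutation of `[n] = {1, …, n}`. The element `i` of `Fin n`
represents the letter `i + 1`. -/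
def word {n : ℕ} (σ : Equiv.Perm (Fin n)) : List ℕ :=
  List.ofFn fun i => (σ i : ℕ) + 1

/-- `σ` is simsun: for every `k`, the subword of `σ` formed by the letters in `{1, …, k}`, in the
order in which they appear in `σ`, has no double descent. -/
def IsSimsun {n : ℕ} (σ : Equiv.Perm (Fin n)) : Prop :=
  ∀ k : ℕ, NoDoubleDescent ((word σ).filter fun x => x ≤ k)

/-- `σ` is double simsun: both `σ` and `σ⁻¹` are simsun. -/
def IsDoubleSimsun {n : ℕ} (σ : Equiv.Perm (Fin n)) : Prop :=
  IsSimsun σ ∧ IsSimsun σ⁻¹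

/-- `σ` contains the pattern `p = p₁ ⋯ pₜ`: there are indices `i₁ < ⋯ < iₜ` such that
`σ (iⱼ) < σ (iₖ)` if and only if `pⱼ < pₖ`. -/
def ContainsPattern {n t : ℕ} (p : Fin t → ℕ) (σ : Equiv.Perm (Fin n)) : Prop :=
  ∃ i : Fin t → Fin n, StrictMono i ∧ ∀ j k : Fin t, σ (i j) < σ (i k) ↔ p j < p k

/-- The set of `p`-avoiding double simsun permutations of `[n]`. -/
def DRS (n : ℕ) {t : ℕ} (p : Fin t → ℕ) : Set (Equiv.Perm (Fin n)) :=
  {σ | IsDoubleSimsun σ ∧ ¬ ContainsPattern p σ}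

/-- `Γ(σ)ᵢ = n + 1 - σ⁻¹(n + 1 - i)`; on `Fin n` the map `i ↦ n + 1 - i` is `Fin.rev`. -/
def Gam {n : ℕ} (σ : Equiv.Perm (Fin n)) : Equiv.Perm (Fin n) :=
  Fin.revPerm * σ⁻¹ * Fin.revPerm

/-- The generalized Catalan numbers `1, 1, 1, 2, 4, 8, 17, 37, …` (OEIS A004148):
`a 0 = 1` and `a (m + 1) = a m + ∑_{k = 1}^{m - 1} a k * a (m - 1 - k)`.
In the last clause `m = n + 1`, and `k + 1` runs through `1, …, n`; `k.rev = n - (k + 1)`. -/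
def genCatalan : ℕ → ℕ
  | 0 => 1
  | 1 => 1
  | n + 2 => genCatalan (n + 1) + ∑ k : Fin n, genCatalan (k + 1) * genCatalan k.rev
decreasing_by all_goals omega

/-- The secondary structure number `Sₙ`, indexed so that `S₀, S₁, S₂, … = 1, 1, 2, 4, 8, 17, …`. -/
def secondaryStructureNumber (n : ℕ) : ℕ := genCatalan (n + 1)

/-- The steps of Motzkin paths: up `(1, 1)`, down `(1, -1)`, level `(1, 0)`. -/
inductive Step : Type
  | U : Step
  | D : Step
  | L : Step

/-- The vertical displacement of a step. -/
def Step.rise : Step → ℤ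
  | .U => 1
  | .D => -1
  | .L => 0

/-- The end height of a lattice path starting at the origin. -/
def height (w : List Step) : ℤ := (w.map Step.rise).sum

/-- The Motzkin paths of length `n`: lattice paths from `(0, 0)` to `(n, 0)` that never pass below
the horizontal axis. -/
def MotzkinPaths (n : ℕ) : Set (List Step) :=
  {w | w.length = n ∧ height w = 0 ∧ ∀ v : List Step, v <+: w → 0 ≤ height v}

/-- The Motzkin paths of length `n` without two consecutive up steps. -/
def UUFreeMotzkinPaths (n : ℕ) : Set (List Step) :=
  {w | w ∈ MotzkinPaths n ∧ ¬ [Step.U, Step.U] <:+: w}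

end Simsun

/-!
A permutation avoiding `132` is a skew sum: if its maximum stands between the blocks `L` and `R`,
then every value of `L` exceeds every value of `R` (`exists_skew_eq`). The double simsun condition
is read off this decomposition as follows.

A permutation is simsun exactly when it has no decreasing triple whose outer positions enclose,
besides the middle entry, only values larger than the triple (`isSimsun_iff`); for the inverse,
positions and values trade places (`hasUpperTriple_inv_iff`). For a skew sum with nonempty `R`,
such triples lie inside a block or straddle both, and this gives (`good_skew_iff`): the skew sum
is double simsun if and only if both blocks are, `L` has no `UpperPair` (no restriction of `L` to
small values ends with a descent) and `R` has no `InvUpperPair` (the same for its inverse). Both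
conditions on pairs decompose as well (`upperPair_skew_iff`, `invUpperPair_skew_iff`), so the
numbers of double simsun permutations subject to none, either or both of them satisfy a closed
system of convolution recursions. Its solution is a shift of `genCatalan` in each of the four
cases: `innerCount_succ_eq`, `leftCount_eq`, `rightCount_eq`, and finally `goodCount_eq`.

Motzkin paths without two consecutive up steps satisfy the same recursion, by cutting a path that
starts with an up step at its first return to the axis; the part in between must not start with an
up step (`ncard_paths`).

The map `Gam` reflects the graph of a permutation in the antidiagonal. This turns `132` into
`213`, and the enclosed values larger than the triple into enclosed values smaller than the
triple. For a `132`-avoiding permutation, the two versions of the condition, each imposed on the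
permutation and on its inverse, are equivalent (`upperTriple_iff_lowerTriple`), because a
forbidden triple of one kind can be moved to one of the other kind.
-/

open Finset.HasAntidiagonal (antidiagonal mem_antidiagonal)

namespace Simsun

/-! ### Double descents in terms of one-line notation -/

/-- In a strictly increasing list, three entries are consecutive exactly when no entry other than
the middle one lies strictly between the outer two. -/
lemma triple_infix_iff_of_sorted {α : Type*} [LinearOrder α] {q : List α}
    (hq : q.Pairwise (· < ·)) (i j k : α) :
    [i, j, k] <:+: q ↔ i ∈ q ∧ j ∈ q ∧ k ∈ q ∧ i < j ∧ j < k ∧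
      ∀ m ∈ q, i < m → m < k → m = j := by
  constructor
  · rintro ⟨s, t, rfl⟩
    simp only [List.pairwise_append, List.pairwise_cons, List.mem_append, List.mem_cons,
      List.not_mem_nil, or_false] at hq ⊢
    grind [lt_irrefl, lt_asymm]
  · rintro ⟨hi, hj, hk, hij, hjk, hm⟩
    obtain ⟨s, t, rfl⟩ := List.append_of_mem hi
    simp only [List.pairwise_append, List.pairwise_cons, List.mem_append, List.mem_cons] at *
    rcases t with _ | ⟨x, t⟩
    · grind
    have hx : x = j := by
      simp only [List.pairwise_cons, List.mem_cons] at *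
      have hix : i < x := hq.2.1.1 x (Or.inl rfl)
      by_contra hne
      have := hm x (by simp) hix
      grind [lt_irrefl, lt_asymm]
    subst hx
    rcases t with _ | ⟨y, t⟩
    · grind [lt_irrefl, lt_asymm]
    have hy : y = k := by
      simp only [List.pairwise_cons, List.mem_cons] at *
      have hxy : x < y := hq.2.1.2.1 y (Or.inl rfl)
      by_contra hne
      have := hm y (by simp) (hij.trans hxy)
      grind [lt_irrefl, lt_asymm]
    subst hy
    exact ⟨s, t, by simp⟩

/-- A decreasing triple of entries such that all the other entries standing between its outer
positions are larger than the triple. Such a triple becomes a double descent once the letters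
exceeding its first entry are deleted. -/
def HasUpperTriple {α : Type*} [LT α] (σ : Equiv.Perm α) : Prop :=
  ∃ i j k, i < j ∧ j < k ∧ σ k < σ j ∧ σ j < σ i ∧
    ∀ m, i < m → m < k → m ≠ j → σ i < σ m

lemma isSimsun_iff {n : ℕ} (σ : Equiv.Perm (Fin n)) : IsSimsun σ ↔ ¬ HasUpperTriple σ := by
  have hw : ∀ K : ℕ, (word σ).filter (fun x => x ≤ K) =
      ((List.finRange n).filter fun i => (σ i : ℕ) + 1 ≤ K).map fun i => (σ i : ℕ) + 1 := by
    intro K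
    rw [word, List.ofFn_eq_map, List.filter_map]
    rfl
  have hs : ∀ K : ℕ, ((List.finRange n).filter fun i => (σ i : ℕ) + 1 ≤ K).Pairwise (· < ·) :=
    fun K => (List.pairwise_lt_finRange n).filter _
  constructor
  · rintro h ⟨i, j, k, hij, hjk, hkj, hji, hm⟩
    refine h (σ i + 1) (σ i + 1) (σ j + 1) (σ k + 1) (by simpa using hji) (by simpa using hkj) ?_
    rw [hw]
    refine List.IsInfix.map (fun i => (σ i : ℕ) + 1) (l₁ := [i, j, k]) ?_
    rw [triple_infix_iff_of_sorted (hs _)]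
    simp only [List.mem_filter, List.mem_finRange, true_and, decide_eq_true_eq]
    refine ⟨le_rfl, by omega, by omega, hij, hjk, fun m hmi him hmk => ?_⟩
    by_contra hne
    have := hm m him hmk hne
    omega
  · intro h K a b c hab hbc hinf
    rw [hw] at hinf
    obtain ⟨l, hl, he⟩ := List.infix_map_iff.mp hinf
    obtain ⟨i, j, k, rfl⟩ : ∃ i j k, l = [i, j, k] := by
      rw [← List.length_eq_three]
      simpa using (congrArg List.length he).symm
    simp only [List.map_cons, List.map_nil, List.cons.injEq, and_true] at he
    rw [triple_infix_iff_of_sorted (hs _)] at hl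
    simp only [List.mem_filter, List.mem_finRange, true_and, decide_eq_true_eq] at hl
    obtain ⟨hi, hj, hk, hij, hjk, hm⟩ := hl
    refine h ⟨i, j, k, hij, hjk, by omega, by omega, fun m him hmk hne => ?_⟩
    by_contra hlt
    exact hne (hm m (by omega) him hmk)

/-- The condition `HasUpperTriple σ⁻¹` in terms of `σ`: a decreasing triple such that all the other
entries whose values lie between its outer values stand to the right of the triple. -/
lemma hasUpperTriple_inv_iff {α : Type*} [LT α] (σ : Equiv.Perm α) :
    HasUpperTriple σ⁻¹ ↔ ∃ i j k, i < j ∧ j < k ∧ σ k < σ j ∧ σ j < σ i ∧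
      ∀ m, σ k < σ m → σ m < σ i → m ≠ j → k < m := by
  constructor
  · rintro ⟨a, b, c, hab, hbc, hcb, hba, hm⟩
    refine ⟨σ⁻¹ c, σ⁻¹ b, σ⁻¹ a, hcb, hba, by simpa, by simpa, fun m h1 h2 hne => ?_⟩
    simpa using hm (σ m) (by simpa using h1) (by simpa using h2)
      (fun h => hne (by simp [← h]))
  · rintro ⟨i, j, k, hij, hjk, hkj, hji, hm⟩
    refine ⟨σ k, σ j, σ i, hkj, hji, by simpa, by simpa, fun m h1 h2 hne => ?_⟩
    simpa using hm (σ⁻¹ m) (by simpa using h1) (by simpa using h2)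
      (fun h => hne (by simp [← h]))

/-- Containment of the pattern `132`. -/
def Has132 {α : Type*} [LT α] (σ : Equiv.Perm α) : Prop :=
  ∃ i j k, i < j ∧ j < k ∧ σ i < σ k ∧ σ k < σ j

lemma containsPattern_132_iff {n : ℕ} (σ : Equiv.Perm (Fin n)) :
    ContainsPattern ![1, 3, 2] σ ↔ Has132 σ := by
  constructor
  · rintro ⟨i, hi, h⟩
    exact ⟨i 0, i 1, i 2, hi (by decide), hi (by decide), (h 0 2).2 (by simp), (h 2 1).2 (by simp)⟩
  · rintro ⟨i, j, k, hij, hjk, h1, h2⟩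
    refine ⟨![i, j, k], ?_, fun a b => ?_⟩
    · intro a b hab
      fin_cases a <;> fin_cases b <;> (simp_all; try order)
    · fin_cases a <;> fin_cases b <;> simp <;> order

lemma containsPattern_213_iff {n : ℕ} (σ : Equiv.Perm (Fin n)) :
    ContainsPattern ![2, 1, 3] σ ↔ ∃ i j k, i < j ∧ j < k ∧ σ j < σ i ∧ σ i < σ k := by
  constructor
  · rintro ⟨i, hi, h⟩
    exact ⟨i 0, i 1, i 2, hi (by decide), hi (by decide), (h 1 0).2 (by simp), (h 0 2).2 (by simp)⟩
  · rintro ⟨i, j, k, hij, hjk, h1, h2⟩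
    refine ⟨![i, j, k], ?_, fun a b => ?_⟩
    · intro a b hab
      fin_cases a <;> fin_cases b <;> (simp_all; try order)
    · fin_cases a <;> fin_cases b <;> simp <;> order

lemma has132_inv {α : Type*} [LT α] {σ : Equiv.Perm α} (h : Has132 σ⁻¹) : Has132 σ := by
  obtain ⟨i, j, k, hij, hjk, h1, h2⟩ := h
  exact ⟨σ⁻¹ i, σ⁻¹ k, σ⁻¹ j, h1, h2, by simpa, by simpa⟩

/-! ### The involution -/

/-- A decreasing triple such that all the other entries standing between its outer positions are
smaller than the triple: the mirror image of `HasUpperTriple`. -/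
def HasLowerTriple {α : Type*} [LT α] (σ : Equiv.Perm α) : Prop :=
  ∃ i j k, i < j ∧ j < k ∧ σ k < σ j ∧ σ j < σ i ∧
    ∀ m, i < m → m < k → m ≠ j → σ m < σ k

lemma hasLowerTriple_inv_iff {α : Type*} [LT α] (σ : Equiv.Perm α) :
    HasLowerTriple σ⁻¹ ↔ ∃ i j k, i < j ∧ j < k ∧ σ k < σ j ∧ σ j < σ i ∧
      ∀ m, σ k < σ m → σ m < σ i → m ≠ j → m < i := by
  constructor
  · rintro ⟨a, b, c, hab, hbc, hcb, hba, hm⟩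
    refine ⟨σ⁻¹ c, σ⁻¹ b, σ⁻¹ a, hcb, hba, by simpa, by simpa, fun m h1 h2 hne => ?_⟩
    simpa using hm (σ m) (by simpa using h1) (by simpa using h2)
      (fun h => hne (by simp [← h]))
  · rintro ⟨i, j, k, hij, hjk, hkj, hji, hm⟩
    refine ⟨σ k, σ j, σ i, hkj, hji, by simpa, by simpa, fun m h1 h2 hne => ?_⟩
    simpa using hm (σ⁻¹ m) (by simpa using h1) (by simpa using h2)
      (fun h => hne (by simp [← h]))

lemma hasUpperTriple_inv_of_hasLowerTriple {α : Type*} [LinearOrder α] [Finite α]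
    {σ : Equiv.Perm α} (h132 : ¬ Has132 σ) (h : HasLowerTriple σ) : HasUpperTriple σ⁻¹ := by
  rw [hasUpperTriple_inv_iff]
  obtain ⟨i, j, k, hij, hjk, hkj, hji, hm⟩ := h
  -- Keep `j` and `k`, and let the first entry be the smallest one exceeding `σ j` on its left.
  obtain ⟨i', ⟨hi'j, hi'⟩, hmin⟩ := Set.exists_min_image {x | x < j ∧ σ j < σ x} σ
    (Set.toFinite _) ⟨i, hij, hji⟩
  refine ⟨i', j, k, hi'j, hjk, hkj, hi', fun m h1 h2 hne => ?_⟩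
  by_contra hkm
  have hmk : m < k := lt_of_le_of_ne (not_lt.mp hkm) (by rintro rfl; exact h1.false)
  have hmj : m < j := by
    by_contra hjm
    have hjm' : j < m := lt_of_le_of_ne (not_lt.mp hjm) (Ne.symm hne)
    exact (hm m (hij.trans hjm') hmk hne).asymm h1
  rcases lt_or_gt_of_ne (σ.injective.ne hne) with h3 | h3
  · rcases lt_trichotomy m i with h4 | rfl | h4
    · exact h132 ⟨m, i, j, h4, hij, h3, hji⟩
    · exact h3.asymm hji
    · exact (hm m h4 hmk hne).asymm h1
  · exact (hmin m ⟨hmj, h3⟩).not_gt h2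

lemma hasLowerTriple_or_of_hasUpperTriple {α : Type*} [LinearOrder α] [Finite α]
    {σ : Equiv.Perm α} (h132 : ¬ Has132 σ) (h : HasUpperTriple σ) :
    HasLowerTriple σ ∨ HasLowerTriple σ⁻¹ := by
  rw [hasLowerTriple_inv_iff]
  obtain ⟨i, j, k, hij, hjk, hkj, hji, hm⟩ := h
  by_cases hx : ∃ x, j < x ∧ x < k
  · -- An entry between `j` and `k` is large, so by `132`-avoidance every entry to the right of `k`
    -- with value below `σ i` is also below `σ j`.
    obtain ⟨x, hjx, hxk⟩ := hx
    have hix := hm x (hij.trans hjx) hxk hjx.ne'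
    -- The last entry is replaced by the largest entry below `σ j` on the right of `j`.
    right
    obtain ⟨k', ⟨hk'j, hk'⟩, hmax⟩ := Set.exists_max_image {y | j < y ∧ σ y < σ j} σ
      (Set.toFinite _) ⟨k, hjk, hkj⟩
    refine ⟨i, j, k', hij, hk'j, hk', hji, fun m h1 h2 hne => ?_⟩
    by_contra hmi
    have him : i < m := lt_of_le_of_ne (not_lt.mp hmi) (by rintro rfl; exact h2.false)
    rcases lt_trichotomy m k with h4 | rfl | h4
    · exact (hm m him h4 hne).asymm h2
    · exact (hmax m ⟨hjk, hkj⟩).not_gt h1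
    · rcases lt_or_gt_of_ne (σ.injective.ne hne) with h3 | h3
      · exact (hmax m ⟨hjk.trans h4, h3⟩).not_gt h1
      · exact h132 ⟨j, x, m, hjx, hxk.trans h4, h3, h2.trans hix⟩
  · -- Otherwise `j` and `k` are adjacent; take for the first position the one just before `j`.
    left
    obtain ⟨i', hi'j, hmax⟩ := Set.exists_max_image {y | y < j} id (Set.toFinite _) ⟨i, hij⟩
    have hii' : i ≤ i' := hmax i hij
    have hi' : σ j < σ i' := by
      rcases hii'.eq_or_lt with rfl | h1
      · exact hji
      · exact hji.trans (hm i' h1 (lt_trans hi'j hjk) (ne_of_lt hi'j))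
    refine ⟨i', j, k, hi'j, hjk, hkj, hi', fun m h1 h2 hne => ?_⟩
    rcases lt_or_gt_of_ne hne with h3 | h3
    · exact absurd h1 (not_lt.mpr (hmax m h3))
    · exact absurd ⟨m, h3, h2⟩ hx

/-- For `132`-avoiding permutations, the double simsun condition is equivalent to its mirror
image. -/
lemma upperTriple_iff_lowerTriple {α : Type*} [LinearOrder α] [Finite α]
    {σ : Equiv.Perm α} (h132 : ¬ Has132 σ) :
    (HasUpperTriple σ ∨ HasUpperTriple σ⁻¹) ↔ (HasLowerTriple σ ∨ HasLowerTriple σ⁻¹) := by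
  have h132' : ¬ Has132 σ⁻¹ := fun h => h132 (has132_inv h)
  constructor
  · rintro (h | h)
    · exact hasLowerTriple_or_of_hasUpperTriple h132 h
    · simpa [or_comm] using hasLowerTriple_or_of_hasUpperTriple h132' h
  · rintro (h | h)
    · exact Or.inr (hasUpperTriple_inv_of_hasLowerTriple h132 h)
    · exact Or.inl (by simpa using hasUpperTriple_inv_of_hasLowerTriple h132' h)

lemma gam_apply {n : ℕ} (σ : Equiv.Perm (Fin n)) (i : Fin n) :
    Gam σ i = (σ⁻¹ i.rev).rev := rfl

lemma gam_rev_apply {n : ℕ} (σ : Equiv.Perm (Fin n)) (i : Fin n) :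
    Gam σ (σ i).rev = i.rev := by
  simp [gam_apply]

lemma gam_gam {n : ℕ} (σ : Equiv.Perm (Fin n)) : Gam (Gam σ) = σ := by
  have h : (Fin.revPerm : Equiv.Perm (Fin n))⁻¹ = Fin.revPerm := by
    ext i
    simp [Equiv.Perm.inv_def]
  have h' : (Fin.revPerm : Equiv.Perm (Fin n)) * Fin.revPerm = 1 := by
    ext i
    simp
  simp only [Gam, mul_inv_rev, h, inv_inv]
  calc Fin.revPerm * (Fin.revPerm * (σ * Fin.revPerm)) * Fin.revPerm
      = (Fin.revPerm * Fin.revPerm) * σ * (Fin.revPerm * Fin.revPerm) := by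
        simp only [mul_assoc]
    _ = σ := by rw [h']; simp

lemma gam_inv {n : ℕ} (σ : Equiv.Perm (Fin n)) : (Gam σ)⁻¹ = Gam σ⁻¹ := by
  have h : (Fin.revPerm : Equiv.Perm (Fin n))⁻¹ = Fin.revPerm := by
    ext i
    simp [Equiv.Perm.inv_def]
  simp only [Gam, mul_inv_rev, h, inv_inv, mul_assoc]

lemma exists_iff_exists_rev_apply {n : ℕ} (σ : Equiv.Perm (Fin n)) {p : Fin n → Prop} :
    (∃ i, p i) ↔ ∃ i, p (σ i).rev :=
  ((σ.trans Fin.revPerm).surjective.exists (p := p))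

lemma forall_iff_forall_rev_apply {n : ℕ} (σ : Equiv.Perm (Fin n)) {p : Fin n → Prop} :
    (∀ i, p i) ↔ ∀ i, p (σ i).rev :=
  ((σ.trans Fin.revPerm).surjective.forall (p := p))

lemma hasUpperTriple_gam_iff {n : ℕ} (σ : Equiv.Perm (Fin n)) :
    HasUpperTriple (Gam σ) ↔ HasLowerTriple σ⁻¹ := by
  rw [hasLowerTriple_inv_iff, HasUpperTriple, exists_iff_exists_rev_apply σ]
  refine exists_congr fun i => ?_
  rw [exists_iff_exists_rev_apply σ]
  refine exists_congr fun j => ?_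
  rw [exists_iff_exists_rev_apply σ]
  refine exists_congr fun k => ?_
  rw [forall_iff_forall_rev_apply σ]
  simp only [gam_rev_apply, Fin.rev_lt_rev, ne_eq, Fin.rev_inj, σ.injective.eq_iff]
  grind

lemma containsPattern_gam_iff {n : ℕ} (σ : Equiv.Perm (Fin n)) :
    ContainsPattern ![2, 1, 3] (Gam σ) ↔ ContainsPattern ![1, 3, 2] σ := by
  rw [containsPattern_132_iff, containsPattern_213_iff]
  constructor
  · rintro ⟨i, j, k, hij, hjk, h1, h2⟩
    simp only [gam_apply, Fin.rev_lt_rev] at h1 h2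
    exact ⟨_, _, _, h2, h1, by simpa, by simpa⟩
  · rintro ⟨i, j, k, hij, hjk, h1, h2⟩
    exact ⟨(σ j).rev, (σ k).rev, (σ i).rev, by simpa, by simpa, by simpa [gam_rev_apply],
      by simpa [gam_rev_apply]⟩

lemma gam_mem_DRS_iff {n : ℕ} (σ : Equiv.Perm (Fin n)) :
    Gam σ ∈ DRS n ![2, 1, 3] ↔ σ ∈ DRS n ![1, 3, 2] := by
  simp only [DRS, IsDoubleSimsun, Set.mem_ofPred_eq, isSimsun_iff, gam_inv, containsPattern_gam_iff,
    hasUpperTriple_gam_iff, inv_inv]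
  refine and_congr_left fun h => ?_
  rw [containsPattern_132_iff] at h
  have := upperTriple_iff_lowerTriple h
  tauto

lemma gam_bijOn (n : ℕ) : Set.BijOn Gam (DRS n ![1, 3, 2]) (DRS n ![2, 1, 3]) := by
  refine ⟨fun σ hσ => (gam_mem_DRS_iff σ).2 hσ,
    (Function.Involutive.injective gam_gam).injOn, fun τ hτ => ⟨Gam τ, ?_, gam_gam τ⟩⟩
  rw [← gam_mem_DRS_iff, gam_gam]
  exact hτ

/-! ### The recursion for the secondary structure numbers -/

lemma genCatalan_add_two (n : ℕ) : genCatalan (n + 2) = genCatalan (n + 1) +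
    ∑ k ∈ Finset.range n, genCatalan (k + 1) * genCatalan (n - 1 - k) := by
  rw [genCatalan, Finset.sum_range]
  congr 1
  refine Finset.sum_congr rfl fun k _ => ?_
  congr 2
  rw [Fin.val_rev]
  omega

lemma genCatalan_add_three (n : ℕ) : genCatalan (n + 3) = genCatalan (n + 2) +
    ∑ p ∈ antidiagonal n, genCatalan (p.1 + 1) * genCatalan p.2 := by
  rw [genCatalan_add_two, Finset.Nat.sum_antidiagonal_eq_sum_range_succ_mk]
  simp

lemma genCatalan_add_three' (n : ℕ) : genCatalan (n + 3) = genCatalan (n + 2) +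
    ∑ p ∈ antidiagonal n, genCatalan p.1 * genCatalan (p.2 + 1) := by
  rw [genCatalan_add_three, ← Finset.Nat.sum_antidiagonal_swap]
  simp [mul_comm]

/-- The cardinality of a disjoint union of sets, each parametrized injectively by a product. -/
lemma ncard_biUnion_image2 {ι α β γ : Type*} (s : Finset ι) (F : ι → α → β → γ)
    (A : ι → Set α) (B : ι → Set β) (hA : ∀ i ∈ s, (A i).Finite) (hB : ∀ i ∈ s, (B i).Finite)
    (hF : ∀ i ∈ s, ∀ j ∈ s, ∀ a ∈ A i, ∀ b ∈ B i, ∀ a' ∈ A j, ∀ b' ∈ B j,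
      F i a b = F j a' b' → i = j ∧ a = a' ∧ b = b') :
    (⋃ i ∈ s, Set.image2 (F i) (A i) (B i)).ncard = ∑ i ∈ s, (A i).ncard * (B i).ncard := by
  classical
  induction s using Finset.induction_on with
  | empty => simp
  | insert i s hi ih =>
    have hfin : ∀ j ∈ insert i s, (Set.image2 (F j) (A j) (B j)).Finite :=
      fun j hj => (hA j hj).image2 _ (hB j hj)
    have hdisj : Disjoint (Set.image2 (F i) (A i) (B i))
        (⋃ j ∈ s, Set.image2 (F j) (A j) (B j)) := by
      rw [Set.disjoint_left]
      rintro _ ⟨a, ha, b, hb, rfl⟩ h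
      simp only [Set.mem_iUnion] at h
      obtain ⟨j, hj, a', ha', b', hb', h⟩ := h
      have := (hF j (by simp [hj]) i (by simp) a' ha' b' hb' a ha b hb h).1
      exact hi (this ▸ hj)
    rw [Finset.set_biUnion_insert, Finset.sum_insert hi,
      Set.ncard_union_eq hdisj (hfin i (by simp))
        (s.finite_toSet.biUnion fun j hj => hfin j (by simp [Finset.mem_coe.mp hj])), ih]
    · congr 1
      rw [← Set.image_uncurry_prod, Set.InjOn.ncard_image, Set.ncard_prod]
      rintro ⟨a, b⟩ ⟨ha, hb⟩ ⟨a', b'⟩ ⟨ha', hb'⟩ h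
      have := hF i (by simp) i (by simp) a ha b hb a' ha' b' hb' h
      simp [this]
    · exact fun i hi => hA i (by simp [hi])
    · exact fun i hi => hB i (by simp [hi])
    · exact fun i hi j hj => hF i (by simp [hi]) j (by simp [hj])

/-! ### Motzkin paths -/

lemma uu_infix_iff (w : List Step) : ¬ [Step.U, Step.U] <:+: w ↔
    w.IsChain fun a b => ¬ (a = Step.U ∧ b = Step.U) := by
  rw [List.isChain_iff_forall_rel_of_append_cons_cons]
  constructor
  · rintro h a b s t rfl ⟨rfl, rfl⟩
    exact h ⟨s, t, by simp⟩
  · rintro h ⟨s, t, rfl⟩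
    exact h (a := Step.U) (b := Step.U) (l₁ := s) (l₂ := t) (by simp) ⟨rfl, rfl⟩

@[simp] lemma height_nil : height [] = 0 := rfl

@[simp] lemma height_cons (a : Step) (w : List Step) : height (a :: w) = a.rise + height w := by
  simp [height]

@[simp] lemma height_append (v w : List Step) : height (v ++ w) = height v + height w := by
  simp [height]

@[simp] lemma rise_U : Step.U.rise = 1 := rfl

@[simp] lemma rise_D : Step.D.rise = -1 := rfl

@[simp] lemma rise_L : Step.L.rise = 0 := rfl

/-- A path that starts at height `h` and ends below the axis crosses the axis for the first time by
some down step. -/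
lemma exists_first_crossing (t : List Step) (h : ℤ) (h0 : 0 ≤ h) (ht : h + height t < 0) :
    ∃ u w, t = u ++ Step.D :: w ∧ h + height u = 0 ∧ ∀ v, v <+: u → 0 ≤ h + height v := by
  induction t generalizing h with
  | nil => simp at ht; omega
  | cons a t ih =>
    by_cases hD : a = Step.D ∧ h = 0
    · obtain ⟨rfl, rfl⟩ := hD
      exact ⟨[], t, by simp, by simp, by simp⟩
    · have h1 : 0 ≤ h + a.rise := by
        cases a <;> simp at hD ⊢ <;> omega
      obtain ⟨u, w, rfl, hu, hv⟩ := ih (h + a.rise) h1 (by simpa [add_assoc] using ht)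
      refine ⟨a :: u, w, rfl, by simpa [add_assoc] using hu, fun v hvu => ?_⟩
      rcases List.prefix_cons_iff.mp hvu with rfl | ⟨v', rfl, hvu'⟩
      · simpa using h0
      · simpa [add_assoc] using hv v' hvu'

/-- The paths in `UUFreeMotzkinPaths n` that do not start with an up step. -/
def FlatStartPaths (n : ℕ) : Set (List Step) :=
  {w | w ∈ UUFreeMotzkinPaths n ∧ w.head? ≠ some Step.U}

lemma mem_UUFreeMotzkinPaths {n : ℕ} {w : List Step} : w ∈ UUFreeMotzkinPaths n ↔
    w.length = n ∧ height w = 0 ∧ (∀ v : List Step, v <+: w → 0 ≤ height v) ∧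
      w.IsChain fun a b => ¬ (a = Step.U ∧ b = Step.U) := by
  simp only [UUFreeMotzkinPaths, MotzkinPaths, Set.mem_ofPred_eq, uu_infix_iff, and_assoc]

lemma level_cons_mem_iff {n : ℕ} {w : List Step} :
    Step.L :: w ∈ UUFreeMotzkinPaths (n + 1) ↔ w ∈ UUFreeMotzkinPaths n := by
  have hp : (∀ v, v <+: Step.L :: w → 0 ≤ height v) ↔ ∀ v, v <+: w → 0 ≤ height v := by
    refine ⟨fun h v hv => by simpa using h (Step.L :: v) (by simpa using hv), fun h v hv => ?_⟩
    rcases List.prefix_cons_iff.mp hv with rfl | ⟨v', rfl, hv'⟩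
    · simp
    · simpa using h v' hv'
  simp only [mem_UUFreeMotzkinPaths, hp, List.isChain_cons]
  simp

/-- The first-return composition: the path `u` raised by one, followed by the path `w`. -/
def liftAppend (u w : List Step) : List Step := Step.U :: (u ++ Step.D :: w)

lemma liftAppend_mem {a b : ℕ} {u w : List Step} (hu : u ∈ FlatStartPaths a)
    (hw : w ∈ UUFreeMotzkinPaths b) : liftAppend u w ∈ UUFreeMotzkinPaths (a + b + 2) := by
  obtain ⟨hu, hs⟩ := hu
  rw [mem_UUFreeMotzkinPaths] at *
  obtain ⟨hul, huh, hup, huc⟩ := hu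
  obtain ⟨hwl, hwh, hwp, hwc⟩ := hw
  refine ⟨by simp [liftAppend]; omega, by simp [liftAppend, huh, hwh], fun v hv => ?_, ?_⟩
  · rcases List.prefix_cons_iff.mp hv with rfl | ⟨v, rfl, hv⟩
    · simp
    · obtain ⟨t, ht⟩ := hv
      rw [liftAppend, List.cons_append, List.cons.injEq] at ht
      rcases List.append_eq_append_iff.mp ht.2 with ⟨x, rfl, -⟩ | ⟨x, rfl, hx⟩
      · have := hup v ⟨x, rfl⟩
        simp; omega
      · rcases List.prefix_cons_iff.mp (⟨t, hx.symm⟩ : x <+: Step.D :: w) with rfl | ⟨v', rfl, hv'⟩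
        · simp [huh]
        · have := hwp v' hv'
          simp [huh]; omega
  · rw [liftAppend, List.isChain_cons, List.isChain_append, List.isChain_cons]
    refine ⟨?_, huc, ⟨by simp, hwc⟩, by simp⟩
    rcases u with _ | ⟨a, u⟩
    · simp
    · simpa using hs

lemma exists_liftAppend {n : ℕ} {t : List Step} (h : Step.U :: t ∈ UUFreeMotzkinPaths n) :
    ∃ a b u w, a + b + 2 = n ∧ u ∈ FlatStartPaths a ∧ w ∈ UUFreeMotzkinPaths b ∧
      Step.U :: t = liftAppend u w := by
  rw [mem_UUFreeMotzkinPaths] at h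
  obtain ⟨hl, hh, hp, hc⟩ := h
  obtain ⟨u, w, rfl, hu, hv⟩ := exists_first_crossing t 0 le_rfl (by simp at hh; omega)
  simp only [zero_add] at hu hv
  rw [List.isChain_cons, List.isChain_append, List.isChain_cons] at hc
  refine ⟨u.length, w.length, u, w, by simp at hl; omega, ⟨?_, ?_⟩, ?_, rfl⟩
  · exact mem_UUFreeMotzkinPaths.2 ⟨rfl, hu, hv, hc.2.1⟩
  · rcases u with _ | ⟨a, u⟩
    · simp
    · simpa using hc.1
  · refine mem_UUFreeMotzkinPaths.2 ⟨rfl, by simp at hh; omega, fun v hv => ?_, hc.2.2.1.2⟩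
    have := hp (Step.U :: (u ++ Step.D :: v)) (by simpa [List.prefix_append_right_inj] using hv)
    simp at this
    omega

lemma length_le_of_append_D_eq {u u' w w' : List Step} (hu : height u = 0)
    (hu' : ∀ v, v <+: u' → 0 ≤ height v) (h : u ++ Step.D :: w = u' ++ Step.D :: w') :
    u'.length ≤ u.length := by
  by_contra hlt
  have h1 : u ++ [Step.D] <+: u' := by
    refine List.prefix_of_prefix_length_le (l₃ := u' ++ Step.D :: w') ?_ ⟨_, rfl⟩ (by simp; omega)
    rw [← h]
    exact ⟨w, by simp⟩
  have := hu' _ h1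
  simp [hu] at this

lemma liftAppend_inj {a b a' b' : ℕ} {u w u' w' : List Step} (hu : u ∈ FlatStartPaths a)
    (hw : w ∈ UUFreeMotzkinPaths b) (hu' : u' ∈ FlatStartPaths a')
    (hw' : w' ∈ UUFreeMotzkinPaths b') (h : liftAppend u w = liftAppend u' w') :
    (a, b) = (a', b') ∧ u = u' ∧ w = w' := by
  have h1 := mem_UUFreeMotzkinPaths.1 hu.1
  have h2 := mem_UUFreeMotzkinPaths.1 hu'.1
  have h3 := mem_UUFreeMotzkinPaths.1 hw
  have h4 := mem_UUFreeMotzkinPaths.1 hw'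
  simp only [liftAppend, List.cons.injEq, true_and] at h
  have hlen : u.length = u'.length :=
    le_antisymm (length_le_of_append_D_eq h2.2.1 h1.2.2.1 h.symm)
      (length_le_of_append_D_eq h1.2.1 h2.2.2.1 h)
  obtain ⟨rfl, h⟩ := List.append_inj h hlen
  obtain rfl : w = w' := by simpa using h
  simp [← h1.1, ← h2.1, ← h3.1, ← h4.1]

lemma finite_UUFreeMotzkinPaths (n : ℕ) : (UUFreeMotzkinPaths n).Finite := by
  have : Finite Step := Finite.of_surjective
    (fun i : Fin 3 => ![Step.U, Step.D, Step.L] i) fun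
      | .U => ⟨0, rfl⟩
      | .D => ⟨1, rfl⟩
      | .L => ⟨2, rfl⟩
  exact (List.finite_length_eq Step n).subset fun w hw => hw.1.1

lemma finite_FlatStartPaths (n : ℕ) : (FlatStartPaths n).Finite :=
  (finite_UUFreeMotzkinPaths n).subset fun _ hw => hw.1

lemma UUFreeMotzkinPaths_zero : UUFreeMotzkinPaths 0 = {[]} := by
  ext w
  rw [mem_UUFreeMotzkinPaths, List.length_eq_zero_iff, Set.mem_singleton_iff]
  refine ⟨fun h => h.1, ?_⟩
  rintro rfl
  simp

lemma FlatStartPaths_zero : FlatStartPaths 0 = {[]} := by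
  ext w
  rw [FlatStartPaths, UUFreeMotzkinPaths_zero, Set.mem_ofPred_eq, Set.mem_singleton_iff]
  refine ⟨fun h => h.1, ?_⟩
  rintro rfl
  simp

lemma not_down_cons_mem {n : ℕ} {w : List Step} : Step.D :: w ∉ UUFreeMotzkinPaths n := by
  rw [mem_UUFreeMotzkinPaths]
  intro h
  have := h.2.2.1 [Step.D] (by simp)
  simp at this

lemma FlatStartPaths_succ (n : ℕ) :
    FlatStartPaths (n + 1) = (Step.L :: ·) '' UUFreeMotzkinPaths n := by
  ext w
  constructor
  · rintro ⟨hw, hs⟩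
    rcases w with _ | ⟨_ | _ | _, w⟩
    · simp [mem_UUFreeMotzkinPaths] at hw
    · simp at hs
    · exact absurd hw not_down_cons_mem
    · exact ⟨w, level_cons_mem_iff.1 hw, rfl⟩
  · rintro ⟨w, hw, rfl⟩
    exact ⟨level_cons_mem_iff.2 hw, by simp⟩

lemma UUFreeMotzkinPaths_one : UUFreeMotzkinPaths 1 = FlatStartPaths 1 := by
  refine Set.Subset.antisymm (fun w hw => ⟨hw, fun hs => ?_⟩) fun w hw => hw.1
  rcases w with _ | ⟨a, w⟩
  · simp at hs
  · obtain rfl : a = Step.U := by simpa using hs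
    obtain ⟨a, b, -, -, h, -⟩ := exists_liftAppend hw
    omega

lemma UUFreeMotzkinPaths_add_two (n : ℕ) : UUFreeMotzkinPaths (n + 2) = FlatStartPaths (n + 2) ∪
    ⋃ p ∈ antidiagonal n,
      Set.image2 liftAppend (FlatStartPaths p.1) (UUFreeMotzkinPaths p.2) := by
  ext w
  simp only [Set.mem_union, Set.mem_iUnion, mem_antidiagonal]
  constructor
  · intro hw
    by_cases hs : w.head? = some Step.U
    · right
      rcases w with _ | ⟨a, w⟩
      · simp at hs
      obtain rfl : a = Step.U := by simpa using hs
      obtain ⟨a, b, u, v, hn, hu, hv, h⟩ := exists_liftAppend hw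
      exact ⟨(a, b), by simpa using hn, u, hu, v, hv, h.symm⟩
    · exact Or.inl ⟨hw, hs⟩
  · rintro (hw | ⟨p, rfl, u, hu, v, hv, rfl⟩)
    · exact hw.1
    · exact liftAppend_mem hu hv

/-- Splitting a path at its first return to the axis gives the recursion of `genCatalan`. -/
lemma ncard_paths (n : ℕ) : (UUFreeMotzkinPaths n).ncard = genCatalan (n + 1) ∧
    (FlatStartPaths n).ncard = genCatalan n := by
  induction n using Nat.strong_induction_on with
  | _ n ih =>
    have hflat : (FlatStartPaths n).ncard = genCatalan n := by
      rcases n with _ | n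
      · simp [FlatStartPaths_zero, genCatalan]
      · rw [FlatStartPaths_succ, Set.ncard_image_of_injective _ List.cons_injective]
        exact (ih n (by omega)).1
    refine ⟨?_, hflat⟩
    rcases n with _ | _ | n
    · simp [UUFreeMotzkinPaths_zero, genCatalan]
    · rw [UUFreeMotzkinPaths_one, hflat, genCatalan_add_two]
      simp
    · rw [UUFreeMotzkinPaths_add_two, Set.ncard_union_eq ?_ (finite_FlatStartPaths _) ?_,
        hflat, ncard_biUnion_image2, genCatalan_add_three']
      · congr 1
        refine Finset.sum_congr rfl fun p hp => ?_
        have := mem_antidiagonal.1 hp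
        rw [(ih p.1 (by omega)).2, (ih p.2 (by omega)).1]
      · exact fun p _ => finite_FlatStartPaths _
      · exact fun p _ => finite_UUFreeMotzkinPaths _
      · exact fun p _ q _ u hu w hw u' hu' w' hw' h => liftAppend_inj hu hw hu' hw' h
      · rw [Set.disjoint_left]
        rintro w hw h
        simp only [Set.mem_iUnion] at h
        obtain ⟨p, -, u, -, v, -, rfl⟩ := h
        exact hw.2 (by simp [liftAppend])
      · exact (Finset.finite_toSet _).biUnion fun p _ =>
          (finite_FlatStartPaths _).image2 _ (finite_UUFreeMotzkinPaths _)

/-! ### Permutations avoiding `132` as skew sums -/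

/-- The `132`-avoiding permutations of `{0, …, n - 1}`, encoded as functions on `ℕ` that vanish
from `n` on. -/
def AvoidingPerms (n : ℕ) : Set (ℕ → ℕ) :=
  {f | (∀ i < n, f i < n) ∧ (∀ i < n, ∀ j < n, f i = f j → i = j) ∧ (∀ i, n ≤ i → f i = 0) ∧
    ∀ i j k, i < j → j < k → k < n → f i < f k → ¬ f k < f j}

lemma AvoidingPerms.exists_eq {n : ℕ} {f : ℕ → ℕ} (hf : f ∈ AvoidingPerms n) {v : ℕ}
    (hv : v < n) : ∃ i < n, f i = v := by
  have := Finset.surjOn_of_injOn_of_card_le (s := Finset.range n) (t := Finset.range n) f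
    (fun i hi => by simpa using hf.1 i (by simpa using hi))
    (fun i hi j hj => hf.2.1 i (by simpa using hi) j (by simpa using hj)) le_rfl
    (by simpa using hv : v ∈ (Finset.range n : Set ℕ))
  simpa using this

/-- The skew sum of `f` followed by a new maximum, for `f` of length `l`, with `g` of length `r`:
first `f` raised by `r`, then the value `l + r`, then `g`. -/
def skew (l r : ℕ) (f g : ℕ → ℕ) : ℕ → ℕ := fun i =>
  if i < l then f i + r else if i = l then l + r else g (i - (l + 1))

lemma skew_left {l r : ℕ} {f g : ℕ → ℕ} {i : ℕ} (h : i < l) : skew l r f g i = f i + r :=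
  if_pos h

lemma skew_mid {l r : ℕ} {f g : ℕ → ℕ} : skew l r f g l = l + r := by
  simp [skew]

lemma skew_right {l r : ℕ} {f g : ℕ → ℕ} (i : ℕ) : skew l r f g (l + 1 + i) = g i := by
  simp [skew, show ¬ l + 1 + i < l by omega, show l + 1 + i ≠ l by omega]

/-- A position of a skew sum lies in the left block, at the maximum, or in the right block. -/
lemma position_cases (l i : ℕ) : i < l ∨ i = l ∨ ∃ i', i = l + 1 + i' := by
  rcases lt_trichotomy i l with h | h | h
  · exact Or.inl h
  · exact Or.inr (Or.inl h)
  · exact Or.inr (Or.inr ⟨i - (l + 1), by omega⟩)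

lemma skew_mem {l r : ℕ} {f g : ℕ → ℕ} (hf : f ∈ AvoidingPerms l) (hg : g ∈ AvoidingPerms r) :
    skew l r f g ∈ AvoidingPerms (l + r + 1) := by
  obtain ⟨f1, f2, -, f4⟩ := hf
  obtain ⟨g1, g2, g3, g4⟩ := hg
  refine ⟨fun i hi => ?_, fun i hi j hj h => ?_, fun i hi => ?_, fun i j k hij hjk hk h1 h2 => ?_⟩
  · rcases position_cases l i with h | rfl | ⟨i, rfl⟩
    · have := f1 i h
      rw [skew_left h]; omega
    · rw [skew_mid]; omega
    · have := g1 i (by omega)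
      rw [skew_right]; omega
  · rcases position_cases l i with hi' | hi' | ⟨i, rfl⟩ <;>
    rcases position_cases l j with hj' | hj' | ⟨j, rfl⟩ <;>
    simp only [*, skew_left, skew_mid, skew_right] at h
    · exact f2 i hi' j hj' (by omega)
    · have := f1 i hi'; omega
    · have := g1 j (by omega); omega
    · have := f1 j hj'; omega
    · omega
    · have := g1 j (by omega); omega
    · have := g1 i (by omega); omega
    · have := g1 i (by omega); omega
    · rw [g2 i (by omega) j (by omega) h]
  · obtain ⟨i, rfl⟩ : ∃ i', i = l + 1 + i' := ⟨i - (l + 1), by omega⟩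
    rw [skew_right]
    exact g3 i (by omega)
  · rcases position_cases l k with hk' | rfl | ⟨k, rfl⟩
    · rw [skew_left hk', skew_left (by omega : j < l)] at h2
      rw [skew_left hk', skew_left (by omega : i < l)] at h1
      exact f4 i j k hij hjk hk' (by omega) (by omega)
    · rw [skew_mid, skew_left hjk] at h2
      have := f1 j hjk; omega
    · have := g1 k (by omega)
      rcases position_cases l i with hi' | rfl | ⟨i, rfl⟩
      · rw [skew_left hi', skew_right] at h1; omega
      · rw [skew_mid, skew_right] at h1; omega
      · obtain ⟨j, rfl⟩ : ∃ j', j = l + 1 + j' := ⟨j - (l + 1), by omega⟩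
        simp only [skew_right] at h1 h2
        exact g4 i j k (by omega) (by omega) (by omega) h1 h2

/-- Deleting the maximum of a `132`-avoiding permutation leaves two blocks, and every value of the
left block exceeds every value of the right block. -/
lemma exists_skew_eq {n : ℕ} {f : ℕ → ℕ} (hf : f ∈ AvoidingPerms (n + 1)) :
    ∃ l r, l + r = n ∧ ∃ a ∈ AvoidingPerms l, ∃ b ∈ AvoidingPerms r, skew l r a b = f := by
  obtain ⟨l, hl, hfl⟩ := AvoidingPerms.exists_eq hf (Nat.lt_succ_self n)
  obtain ⟨f1, f2, f3, f4⟩ := hf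
  have hlt : ∀ i < n + 1, i ≠ l → f i < n := fun i hi hne => by
    have h1 := f1 i hi
    have h2 : f i ≠ n := fun h => hne (f2 i hi l hl (by omega))
    omega
  have hsep : ∀ i k, i < l → l < k → k < n + 1 → f k < f i := fun i k hi hk hkn => by
    have h1 := f4 i l k hi hk hkn
    have h2 := hlt k hkn (by omega)
    have h3 : f i ≠ f k := fun h => by have := f2 i (by omega) k hkn h; omega
    omega
  -- The values at the positions to the right of `l` are all smaller than `f i` for `i < l`.
  have hleft : ∀ i < l, n - l ≤ f i := fun i hi => by
    have := Finset.card_le_card_of_injOn (s := Finset.Ioc l n) (t := Finset.range (f i)) f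
      (fun k hk => by
        have := Finset.mem_Ioc.1 hk
        exact Finset.mem_coe.2 (Finset.mem_range.2 (hsep i k hi this.1 (by omega))))
      (fun k hk k' hk' h => f2 k (by have := Finset.mem_Ioc.1 hk; omega) k'
        (by have := Finset.mem_Ioc.1 hk'; omega) h)
    simpa using this
  -- The values at the positions up to `l` are all larger than `f k` for `k > l`.
  have hright : ∀ k, l < k → k < n + 1 → f k < n - l := fun k hk hkn => by
    have := Finset.card_le_card_of_injOn (s := Finset.range (l + 1)) (t := Finset.Ioc (f k) n) f
      (fun i hi => by
        have h1 : i < l + 1 := Finset.mem_range.1 hi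
        have h2 := f1 i (by omega)
        refine Finset.mem_coe.2 (Finset.mem_Ioc.2 ⟨?_, by omega⟩)
        rcases Nat.lt_succ_iff_lt_or_eq.1 h1 with h | rfl
        · exact hsep i k h hk hkn
        · have := hlt k hkn (by omega)
          omega)
      (fun i hi i' hi' h => f2 i (by have := Finset.mem_range.1 hi; omega) i'
        (by have := Finset.mem_range.1 hi'; omega) h)
    simp at this
    omega
  refine ⟨l, n - l, by omega, fun i => if i < l then f i - (n - l) else 0,
    ⟨?_, ?_, ?_, ?_⟩, fun i => f (l + 1 + i), ⟨?_, ?_, ?_, ?_⟩, ?_⟩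
  · intro i hi
    have := hlt i (by omega) (by omega)
    simp only [hi, if_true]
    omega
  · intro i hi j hj h
    have h1 := hleft i hi
    have h2 := hleft j hj
    simp only [hi, hj, if_true] at h
    exact f2 i (by omega) j (by omega) (by omega)
  · intro i hi
    simp [not_lt.2 hi]
  · intro i j k hij hjk hk h1 h2
    have h3 := hleft k hk
    simp only [hk, hjk.trans hk, hij.trans (hjk.trans hk), if_true] at h1 h2
    exact f4 i j k hij hjk (by omega) (by omega) (by omega)
  · exact fun i hi => hright _ (by omega) (by omega)
  · intro i hi j hj h
    have := f2 _ (by omega) _ (by omega) h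
    omega
  · exact fun i hi => f3 _ (by omega)
  · exact fun i j k hij hjk hk => f4 _ _ _ (by omega) (by omega) (by omega)
  · funext i
    rcases position_cases l i with h | rfl | ⟨i, rfl⟩
    · have := hleft i h
      rw [skew_left h]
      simp only [h, if_true]
      omega
    · rw [skew_mid]; omega
    · rw [skew_right]

lemma skew_inj {l r l' r' : ℕ} {f g f' g' : ℕ → ℕ} (hn : l + r = l' + r')
    (hf : f ∈ AvoidingPerms l) (hg : g ∈ AvoidingPerms r) (hf' : f' ∈ AvoidingPerms l')
    (hg' : g' ∈ AvoidingPerms r') (h : skew l r f g = skew l' r' f' g') :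
    (l, r) = (l', r') ∧ f = f' ∧ g = g' := by
  have hl : l = l' := (skew_mem hf hg).2.1 l (by omega) l' (by omega) <| by
    rw [skew_mid, h, skew_mid, hn]
  subst hl
  obtain rfl : r = r' := by omega
  refine ⟨rfl, ?_, ?_⟩
  · funext i
    by_cases hi : i < l
    · have := congrFun h i
      rw [skew_left hi, skew_left hi] at this
      omega
    · rw [hf.2.2.1 i (by omega), hf'.2.2.1 i (by omega)]
  · funext i
    have := congrFun h (l + 1 + i)
    rwa [skew_right, skew_right] at this

lemma finite_AvoidingPerms (n : ℕ) : (AvoidingPerms n).Finite := by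
  induction n using Nat.strong_induction_on with
  | _ n ih =>
    rcases n with _ | n
    · refine (Set.finite_singleton (fun _ => 0)).subset fun f hf => ?_
      exact funext fun i => hf.2.2.1 i (Nat.zero_le i)
    · refine ((antidiagonal n).finite_toSet.biUnion
        (t := fun p => Set.image2 (skew p.1 p.2) (AvoidingPerms p.1) (AvoidingPerms p.2))
        fun p hp => ?_).subset fun f hf => ?_
      · have := mem_antidiagonal.1 (Finset.mem_coe.1 hp)
        exact (ih _ (by omega)).image2 _ (ih _ (by omega))
      · obtain ⟨l, r, hn, a, ha, b, hb, rfl⟩ := exists_skew_eq hf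
        simp only [Set.mem_iUnion]
        exact ⟨(l, r), by simpa using hn, a, ha, b, hb, rfl⟩

/-- Counting `132`-avoiding permutations with a property that the skew sum decomposition splits into
a property of the left block and a property of the right block. -/
lemma ncard_avoidingPerms_succ (n : ℕ) (Q : ℕ → (ℕ → ℕ) → Prop) (A B : ℕ → ℕ → (ℕ → ℕ) → Prop)
    (h : ∀ l r f g, f ∈ AvoidingPerms l → g ∈ AvoidingPerms r →
      (Q (l + r + 1) (skew l r f g) ↔ A l r f ∧ B l r g)) :
    {f ∈ AvoidingPerms (n + 1) | Q (n + 1) f}.ncard =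
      ∑ p ∈ antidiagonal n, {f ∈ AvoidingPerms p.1 | A p.1 p.2 f}.ncard *
        {g ∈ AvoidingPerms p.2 | B p.1 p.2 g}.ncard := by
  rw [← ncard_biUnion_image2 _ (fun p => skew p.1 p.2)]
  · congr 1
    ext f
    simp only [Set.mem_iUnion]
    constructor
    · rintro ⟨hf, hQ⟩
      obtain ⟨l, r, rfl, a, ha, b, hb, rfl⟩ := exists_skew_eq hf
      have := (h l r a b ha hb).1 hQ
      exact ⟨(l, r), by simp, a, ⟨ha, this.1⟩, b, ⟨hb, this.2⟩, rfl⟩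
    · rintro ⟨⟨l, r⟩, hn, a, ⟨ha, hA⟩, b, ⟨hb, hB⟩, rfl⟩
      obtain rfl : l + r = n := by simpa using hn
      exact ⟨skew_mem ha hb, (h l r a b ha hb).2 ⟨hA, hB⟩⟩
  · exact fun p _ => (finite_AvoidingPerms _).subset (Set.sep_subset _ _)
  · exact fun p _ => (finite_AvoidingPerms _).subset (Set.sep_subset _ _)
  · intro p hp q hq f hf g hg f' hf' g' hg' heq
    rw [mem_antidiagonal] at hp hq
    exact skew_inj (by omega) hf.1 hg.1 hf'.1 hg'.1 heq

/-! ### The double simsun condition on skew sums -/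

/-- `HasUpperTriple` for the permutation of `{0, …, n - 1}` given by `f`. -/
def UpperTriple (n : ℕ) (f : ℕ → ℕ) : Prop :=
  ∃ i j k, i < j ∧ j < k ∧ k < n ∧ f k < f j ∧ f j < f i ∧
    ∀ m, i < m → m < k → m ≠ j → f i < f m

/-- `UpperTriple` for the inverse of `f`, in terms of `f`. -/
def InvUpperTriple (n : ℕ) (f : ℕ → ℕ) : Prop :=
  ∃ i j k, i < j ∧ j < k ∧ k < n ∧ f k < f j ∧ f j < f i ∧
    ∀ m < n, f k < f m → f m < f i → m ≠ j → k < m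

/-- For some bound, the word formed by the values below it ends with a descent: `f` followed by
smaller values is not simsun. -/
def UpperPair (n : ℕ) (f : ℕ → ℕ) : Prop :=
  ∃ i j, i < j ∧ j < n ∧ f j < f i ∧ ∀ m < n, i < m → m ≠ j → f i < f m

/-- `UpperPair` for the inverse of `f`, in terms of `f`. -/
def InvUpperPair (n : ℕ) (f : ℕ → ℕ) : Prop :=
  ∃ j k, j < k ∧ k < n ∧ f k < f j ∧ ∀ m < n, f k < f m → m ≠ j → k < m

lemma upperTriple_skew_iff {l r : ℕ} {f g : ℕ → ℕ} (hf : f ∈ AvoidingPerms l)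
    (hg : g ∈ AvoidingPerms r) :
    UpperTriple (l + r + 1) (skew l r f g) ↔
      UpperTriple l f ∨ UpperTriple r g ∨ (0 < r ∧ UpperPair l f) ∨ (1 < r ∧ g 1 < g 0) := by
  have f1 := hf.1
  have g1 := hg.1
  constructor
  · rintro ⟨i, j, k, hij, hjk, hk, hkj, hji, hm⟩
    rcases position_cases l k with hk' | rfl | ⟨k, rfl⟩
    · left
      rw [skew_left hk', skew_left (hjk.trans hk')] at hkj
      rw [skew_left (hjk.trans hk'), skew_left (hij.trans (hjk.trans hk'))] at hji
      refine ⟨i, j, k, hij, hjk, hk', by omega, by omega, fun m him hmk hne => ?_⟩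
      have := hm m him hmk hne
      rw [skew_left (hmk.trans hk'), skew_left (him.trans (hmk.trans hk'))] at this
      omega
    · rw [skew_mid, skew_left hjk] at hkj
      have := f1 j hjk
      omega
    · rcases position_cases l j with hj' | rfl | ⟨j, rfl⟩
      · right; right; left
        rw [skew_left hj', skew_left (hij.trans hj')] at hji
        refine ⟨by omega, i, j, hij, hj', by omega, fun m hml him hne => ?_⟩
        have := hm m him (by omega) hne
        rw [skew_left hml, skew_left (hij.trans hj')] at this
        omega
      · rw [skew_mid, skew_left hij] at hji
        have := f1 i hij
        omega
      · rw [skew_right, skew_right] at hkj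
        rcases Nat.lt_or_ge l i with hi | hi
        · obtain ⟨i, rfl⟩ : ∃ i', i = l + 1 + i' := ⟨i - (l + 1), by omega⟩
          right; left
          rw [skew_right, skew_right] at hji
          refine ⟨i, j, k, by omega, by omega, by omega, hkj, hji, fun m him hmk hne => ?_⟩
          simpa only [skew_right] using hm (l + 1 + m) (by omega) (by omega) (by omega)
        · -- The entries of the right block are small, so `j` and `k` are its first two positions.
          right; right; right
          have hi2 : r ≤ skew l r f g i := by
            rcases hi.lt_or_eq with h | rfl
            · rw [skew_left h]; omega
            · rw [skew_mid]; omega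
          have hbad : ∀ m, l + 1 + m < l + 1 + k → m = j := fun m hmk => by
            by_contra hne
            have h1 := hm (l + 1 + m) (by omega) hmk (by omega)
            rw [skew_right] at h1
            have h2 := g1 m (by omega)
            omega
          obtain rfl : 0 = j := hbad 0 (by omega)
          obtain rfl : k = 1 := by
            by_contra hne
            have := hbad 1 (by omega)
            omega
          exact ⟨by omega, hkj⟩
  · rintro (⟨i, j, k, hij, hjk, hk, hkj, hji, hm⟩ | ⟨i, j, k, hij, hjk, hk, hkj, hji, hm⟩ |
      ⟨hr, i, j, hij, hj, hji, hm⟩ | ⟨hr, h10⟩)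
    · refine ⟨i, j, k, hij, hjk, by omega, ?_, ?_, fun m him hmk hne => ?_⟩
      · rw [skew_left hk, skew_left (hjk.trans hk)]; omega
      · rw [skew_left (hjk.trans hk), skew_left (hij.trans (hjk.trans hk))]; omega
      · rw [skew_left (hmk.trans hk), skew_left (hij.trans (hjk.trans hk))]
        have := hm m him hmk hne
        omega
    · refine ⟨l + 1 + i, l + 1 + j, l + 1 + k, by omega, by omega, by omega, ?_, ?_,
        fun m him hmk hne => ?_⟩
      · simpa only [skew_right] using hkj
      · simpa only [skew_right] using hji
      · obtain ⟨m, rfl⟩ : ∃ m', m = l + 1 + m' := ⟨m - (l + 1), by omega⟩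
        simpa only [skew_right] using hm m (by omega) (by omega) (by omega)
    · have hg0 := g1 0 hr
      have hi1 := f1 i (hij.trans hj)
      refine ⟨i, j, l + 1 + 0, hij, by omega, by omega, ?_, ?_, fun m him hmk hne => ?_⟩
      · rw [skew_right, skew_left hj]; omega
      · rw [skew_left hj, skew_left (hij.trans hj)]; omega
      · rcases Nat.lt_succ_iff_lt_or_eq.1 (hmk : m < l + 1) with h | rfl
        · have := hm m h him hne
          rw [skew_left h, skew_left (hij.trans hj)]
          omega
        · rw [skew_mid, skew_left (hij.trans hj)]
          omega
    · refine ⟨l, l + 1 + 0, l + 1 + 1, by omega, by omega, by omega, ?_, ?_,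
        fun m him hmk hne => by omega⟩
      · simpa only [skew_right] using h10
      · have := g1 0 (by omega)
        rw [skew_right, skew_mid]; omega

lemma invUpperTriple_skew_iff {l r : ℕ} {f g : ℕ → ℕ} (hf : f ∈ AvoidingPerms l)
    (hg : g ∈ AvoidingPerms r) :
    InvUpperTriple (l + r + 1) (skew l r f g) ↔
      InvUpperTriple l f ∨ InvUpperTriple r g ∨ (0 < r ∧ InvUpperPair r g) ∨
        (0 < r ∧ ∃ i j, i < j ∧ j < l ∧ f i = 1 ∧ f j = 0) := by
  have f1 := hf.1
  have g1 := hg.1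
  constructor
  · rintro ⟨i, j, k, hij, hjk, hk, hkj, hji, hm⟩
    rcases position_cases l k with hk' | rfl | ⟨k, rfl⟩
    · left
      rw [skew_left hk', skew_left (hjk.trans hk')] at hkj
      rw [skew_left (hjk.trans hk'), skew_left (hij.trans (hjk.trans hk'))] at hji
      refine ⟨i, j, k, hij, hjk, hk', by omega, by omega, fun m hml h1 h2 hne => ?_⟩
      refine hm m (by omega) ?_ ?_ hne
      · rw [skew_left hml, skew_left hk']; omega
      · rw [skew_left hml, skew_left (hij.trans (hjk.trans hk'))]; omega
    · rw [skew_mid, skew_left hjk] at hkj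
      have := f1 j hjk
      omega
    · rcases position_cases l j with hj' | rfl | ⟨j, rfl⟩
      · -- The entries of the left block precede `k`, so `f i` and `f j` are its smallest values.
        right; right; right
        have hgk := g1 k (by omega)
        rw [skew_left hj', skew_left (hij.trans hj')] at hji
        have hbad : ∀ m < l, f m < f i → m = j := fun m hml hmi => by
          by_contra hne
          have := hm m (by omega) (by rw [skew_left hml, skew_right]; omega)
            (by rw [skew_left hml, skew_left (hij.trans hj')]; omega) hne
          omega
        have hi1 := f1 i (hij.trans hj')
        obtain ⟨a, ha, ha0⟩ := AvoidingPerms.exists_eq hf (v := 0) (by omega)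
        obtain rfl := hbad a ha (by omega)
        obtain ⟨b, hb, hb1⟩ := AvoidingPerms.exists_eq hf (v := 1) (by omega)
        refine ⟨by omega, i, a, hij, hj', ?_, ha0⟩
        by_contra hne
        have := hbad b hb (by omega)
        subst this
        omega
      · rw [skew_mid, skew_left hij] at hji
        have := f1 i hij
        omega
      · rw [skew_right, skew_right] at hkj
        rcases Nat.lt_or_ge l i with hi | hi
        · obtain ⟨i, rfl⟩ : ∃ i', i = l + 1 + i' := ⟨i - (l + 1), by omega⟩
          right; left
          rw [skew_right, skew_right] at hji
          refine ⟨i, j, k, by omega, by omega, by omega, hkj, hji, fun m hmr h1 h2 hne => ?_⟩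
          have := hm (l + 1 + m) (by omega) (by simpa only [skew_right] using h1)
            (by simpa only [skew_right] using h2) (by omega)
          omega
        · right; right; left
          have hi2 : r ≤ skew l r f g i := by
            rcases hi.lt_or_eq with h | rfl
            · rw [skew_left h]; omega
            · rw [skew_mid]; omega
          refine ⟨by omega, j, k, by omega, by omega, hkj, fun m hmr h1 hne => ?_⟩
          have h2 := g1 m hmr
          have := hm (l + 1 + m) (by omega) (by simpa only [skew_right] using h1)
            (by rw [skew_right]; omega) (by omega)
          omega
  · rintro (⟨i, j, k, hij, hjk, hk, hkj, hji, hm⟩ | ⟨i, j, k, hij, hjk, hk, hkj, hji, hm⟩ |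
      ⟨hr, j, k, hjk, hk, hkj, hm⟩ | ⟨hr, i, j, hij, hj, hi1, hj0⟩)
    · have hi1 := f1 i (by omega)
      refine ⟨i, j, k, hij, hjk, by omega, ?_, ?_, fun m hml h1 h2 hne => ?_⟩
      · rw [skew_left hk, skew_left (hjk.trans hk)]; omega
      · rw [skew_left (hjk.trans hk), skew_left (hij.trans (hjk.trans hk))]; omega
      · rw [skew_left hk] at h1
        rw [skew_left (hij.trans (hjk.trans hk))] at h2
        rcases Nat.lt_or_ge m l with h | h
        · rw [skew_left h] at h1 h2
          exact hm m h (by omega) (by omega) hne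
        · omega
    · have hi1 := g1 i (by omega)
      refine ⟨l + 1 + i, l + 1 + j, l + 1 + k, by omega, by omega, by omega, ?_, ?_,
        fun m hml h1 h2 hne => ?_⟩
      · simpa only [skew_right] using hkj
      · simpa only [skew_right] using hji
      · rcases position_cases l m with h | rfl | ⟨m, rfl⟩
        · rw [skew_right, skew_left h] at h2; omega
        · rw [skew_right, skew_mid] at h2; omega
        · rw [skew_right, skew_right] at h1 h2
          have := hm m (by omega) h1 h2 (by omega)
          omega
    · -- The first entry of the triple is the smallest entry preceding the right block.
      have hj1 := g1 j (by omega)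
      obtain ⟨i, hil, hi⟩ : ∃ i ≤ l, skew l r f g i = r := by
        rcases Nat.eq_zero_or_pos l with rfl | hl
        · exact ⟨0, le_rfl, by rw [skew_mid]; omega⟩
        · obtain ⟨i, hil, hi⟩ := AvoidingPerms.exists_eq hf hl
          exact ⟨i, hil.le, by rw [skew_left hil]; omega⟩
      refine ⟨i, l + 1 + j, l + 1 + k, by omega, by omega, by omega, ?_, ?_,
        fun m hml h1 h2 hne => ?_⟩
      · simpa only [skew_right] using hkj
      · rw [hi, skew_right]; exact hj1
      · rw [hi] at h2
        rcases position_cases l m with h | rfl | ⟨m, rfl⟩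
        · rw [skew_left h] at h2; omega
        · rw [skew_mid] at h2; omega
        · rw [skew_right, skew_right] at h1
          have := hm m (by omega) h1 (by omega)
          omega
    · -- The last entry of the triple is the largest entry of the right block.
      obtain ⟨k, hk, hkr⟩ := AvoidingPerms.exists_eq hg (v := r - 1) (by omega)
      refine ⟨i, j, l + 1 + k, hij, by omega, by omega, ?_, ?_, fun m hml h1 h2 hne => ?_⟩
      · rw [skew_right, skew_left hj]; omega
      · rw [skew_left hj, skew_left (hij.trans hj)]; omega
      · rw [skew_left (hij.trans hj)] at h2
        rw [skew_right] at h1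
        rcases position_cases l m with h | rfl | ⟨m, rfl⟩
        · rw [skew_left h] at h1 h2
          exact absurd (hf.2.1 m h j hj (by omega)) hne
        · rw [skew_mid] at h2; omega
        · have := g1 m (by omega)
          rw [skew_right] at h1
          omega

/-- `f` encodes a double simsun permutation. -/
def Good (n : ℕ) (f : ℕ → ℕ) : Prop := ¬ UpperTriple n f ∧ ¬ InvUpperTriple n f

/-- The two conditions on the first two letters of the right block and on the values `0`, `1` of the
left block are absorbed by the conditions on pairs. -/
lemma good_skew_iff {l r : ℕ} {f g : ℕ → ℕ} (hf : f ∈ AvoidingPerms l)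
    (hg : g ∈ AvoidingPerms r) : Good (l + r + 1) (skew l r f g) ↔
      (Good l f ∧ (0 < r → ¬ UpperPair l f)) ∧ (Good r g ∧ (0 < r → ¬ InvUpperPair r g)) := by
  have h1 : (1 < r ∧ g 1 < g 0) → InvUpperPair r g := fun ⟨hr, h⟩ =>
    ⟨0, 1, by omega, hr, h, fun m _ h1 hne => by
      by_contra hm
      obtain rfl : m = 1 := by omega
      omega⟩
  have h2 : (∃ i j, i < j ∧ j < l ∧ f i = 1 ∧ f j = 0) → UpperPair l f :=
    fun ⟨i, j, hij, hj, hi1, hj0⟩ => ⟨i, j, hij, hj, by omega, fun m hm him hne => by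
      have h3 : f m ≠ f j := fun h => hne (hf.2.1 m hm j hj h)
      have h4 : f m ≠ f i := fun h => him.ne' (hf.2.1 m hm i (by omega) h)
      omega⟩
  rw [Good, upperTriple_skew_iff hf hg, invUpperTriple_skew_iff hf hg, Good, Good]
  have h3 : (1 < r ∧ g 1 < g 0) → 0 < r := fun h => by omega
  generalize (∃ i j, i < j ∧ j < l ∧ f i = 1 ∧ f j = 0) = p at *
  generalize (1 < r ∧ g 1 < g 0) = q at *
  generalize UpperTriple l f = a, UpperTriple r g = b, UpperPair l f = c at *
  generalize InvUpperTriple l f = a', InvUpperTriple r g = b', InvUpperPair r g = c' at *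
  by_cases hr : 0 < r
  · simp only [hr, true_and, true_imp_iff]
    tauto
  · simp only [hr, false_and, false_imp_iff, and_true, false_or, or_false]
    tauto

lemma upperPair_skew_iff {l r : ℕ} {f g : ℕ → ℕ} (hf : f ∈ AvoidingPerms l)
    (hg : g ∈ AvoidingPerms r) : UpperPair (l + r + 1) (skew l r f g) ↔
      (r = 0 ∧ UpperPair l f) ∨ r = 1 ∨ UpperPair r g := by
  have f1 := hf.1
  have g1 := hg.1
  constructor
  · rintro ⟨i, j, hij, hj, hji, hm⟩
    rcases Nat.lt_or_ge l i with hi | hi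
    · obtain ⟨i, rfl⟩ : ∃ i', i = l + 1 + i' := ⟨i - (l + 1), by omega⟩
      obtain ⟨j, rfl⟩ : ∃ j', j = l + 1 + j' := ⟨j - (l + 1), by omega⟩
      right; right
      rw [skew_right, skew_right] at hji
      refine ⟨i, j, by omega, by omega, hji, fun m hmr him hne => ?_⟩
      simpa only [skew_right] using hm (l + 1 + m) (by omega) (by omega) (by omega)
    · have hi2 : r ≤ skew l r f g i := by
        rcases hi.lt_or_eq with h | rfl
        · rw [skew_left h]; omega
        · rw [skew_mid]; omega
      -- The only entry of the right block can be the one at `j`.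
      have hbad : ∀ m < r, l + 1 + m = j := fun m hmr => by
        by_contra hne
        have h1 := hm (l + 1 + m) (by omega) (by omega) hne
        rw [skew_right] at h1
        have := g1 m hmr
        omega
      rcases r with _ | _ | r
      · left
        have hil : i < l := by omega
        have hjl : j < l := by
          rcases position_cases l j with h | rfl | ⟨j, rfl⟩
          · exact h
          · rw [skew_mid, skew_left hil] at hji
            have := f1 i hil
            omega
          · omega
        rw [skew_left hil, skew_left hjl] at hji
        refine ⟨rfl, i, j, hij, hjl, by omega, fun m hml him hne => ?_⟩
        simpa only [skew_left hml, skew_left hil, add_zero] using hm m (by omega) him hne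
      · exact Or.inr (Or.inl rfl)
      · have h0 := hbad 0 (by omega)
        have h1 := hbad 1 (by omega)
        omega
  · rintro (⟨rfl, i, j, hij, hj, hji, hm⟩ | rfl | ⟨i, j, hij, hj, hji, hm⟩)
    · have hi1 := f1 i (by omega)
      refine ⟨i, j, hij, by omega, ?_, fun m hml him hne => ?_⟩
      · rw [skew_left hj, skew_left (hij.trans hj)]; omega
      · rw [skew_left (hij.trans hj)]
        rcases Nat.lt_succ_iff_lt_or_eq.1 (hml : m < l + 1) with h | rfl
        · rw [skew_left h]
          have := hm m h him hne
          omega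
        · rw [skew_mid]; omega
    · have := g1 0 one_pos
      refine ⟨l, l + 1 + 0, by omega, by omega, ?_, fun m hml him hne => by omega⟩
      rw [skew_right, skew_mid]; omega
    · refine ⟨l + 1 + i, l + 1 + j, by omega, by omega, by simpa only [skew_right] using hji,
        fun m hml him hne => ?_⟩
      obtain ⟨m, rfl⟩ : ∃ m', m = l + 1 + m' := ⟨m - (l + 1), by omega⟩
      simpa only [skew_right] using hm m (by omega) (by omega) (by omega)

lemma invUpperPair_skew_iff {l r : ℕ} {f g : ℕ → ℕ} (hf : f ∈ AvoidingPerms l)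
    (hg : g ∈ AvoidingPerms r) : InvUpperPair (l + r + 1) (skew l r f g) ↔
      InvUpperPair l f ∨ (l = 0 ∧ 0 < r) := by
  have f1 := hf.1
  have g1 := hg.1
  constructor
  · rintro ⟨j, k, hjk, hk, hkj, hm⟩
    rcases position_cases l k with hk' | rfl | ⟨k, rfl⟩
    · left
      rw [skew_left hk', skew_left (hjk.trans hk')] at hkj
      refine ⟨j, k, hjk, hk', by omega, fun m hml h1 hne => hm m (by omega) ?_ hne⟩
      rw [skew_left hk', skew_left hml]; omega
    · rw [skew_mid, skew_left hjk] at hkj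
      have := f1 j hjk
      omega
    · -- The maximum and the entries of the left block are larger than the entry at `k`.
      right
      have hgk := g1 k (by omega)
      refine ⟨?_, by omega⟩
      have h1 : l = j := by
        by_contra hne
        have := hm l (by omega) (by rw [skew_mid, skew_right]; omega) hne
        omega
      by_contra hl
      have := hm 0 (by omega) (by rw [skew_left (Nat.pos_of_ne_zero hl), skew_right]; omega)
        (by omega)
      omega
  · rintro (⟨j, k, hjk, hk, hkj, hm⟩ | ⟨rfl, hr⟩)
    · refine ⟨j, k, hjk, by omega, ?_, fun m hml h1 hne => ?_⟩
      · rw [skew_left hk, skew_left (hjk.trans hk)]; omega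
      · rcases Nat.lt_or_ge m l with h | h
        · rw [skew_left hk, skew_left h] at h1
          exact hm m h (by omega) hne
        · omega
    · obtain ⟨k, hk, hkr⟩ := AvoidingPerms.exists_eq hg (v := r - 1) (by omega)
      refine ⟨0, 0 + 1 + k, by omega, by omega, ?_, fun m hml h1 hne => ?_⟩
      · rw [skew_right, skew_mid]; omega
      · obtain ⟨m, rfl⟩ : ∃ m', m = 0 + 1 + m' := ⟨m - 1, by omega⟩
        rw [skew_right, skew_right] at h1
        have := g1 m (by omega)
        omega

/-! ### Counting double simsun permutations avoiding `132` -/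

/-- The number of double simsun permutations of `n` letters that avoid `132`. -/
noncomputable def goodCount (n : ℕ) : ℕ := {f ∈ AvoidingPerms n | Good n f}.ncard

/-- Those counted by `goodCount` that stay double simsun when put on the left of a skew sum. -/
noncomputable def leftCount (n : ℕ) : ℕ := {f ∈ AvoidingPerms n | Good n f ∧ ¬ UpperPair n f}.ncard

/-- Those counted by `goodCount` that stay double simsun when put on the right of a skew sum. -/
noncomputable def rightCount (n : ℕ) : ℕ :=
  {f ∈ AvoidingPerms n | Good n f ∧ ¬ InvUpperPair n f}.ncard

/-- Those counted by both `leftCount` and `rightCount`. -/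
noncomputable def innerCount (n : ℕ) : ℕ :=
  {f ∈ AvoidingPerms n | Good n f ∧ ¬ UpperPair n f ∧ ¬ InvUpperPair n f}.ncard

lemma good_zero (f : ℕ → ℕ) : Good 0 f :=
  ⟨fun ⟨_, _, _, _, _, h, _⟩ => by omega, fun ⟨_, _, _, _, _, h, _⟩ => by omega⟩

lemma not_upperPair_zero (f : ℕ → ℕ) : ¬ UpperPair 0 f := fun ⟨_, _, _, h, _⟩ => by omega

lemma not_invUpperPair_zero (f : ℕ → ℕ) : ¬ InvUpperPair 0 f := fun ⟨_, _, _, h, _⟩ => by omega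

lemma ncard_avoidingPerms_zero : (AvoidingPerms 0).ncard = 1 := by
  rw [Set.ncard_eq_one]
  refine ⟨fun _ => 0, Set.ext fun f => ⟨fun hf => funext fun i => hf.2.2.1 i (Nat.zero_le i), ?_⟩⟩
  rintro rfl
  exact ⟨by simp, by simp, by simp, by simp⟩

lemma goodCount_zero : goodCount 0 = 1 := by
  simp [goodCount, good_zero, ncard_avoidingPerms_zero]

lemma leftCount_zero : leftCount 0 = 1 := by
  simp [leftCount, good_zero, not_upperPair_zero, ncard_avoidingPerms_zero]

lemma rightCount_zero : rightCount 0 = 1 := by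
  simp [rightCount, good_zero, not_invUpperPair_zero, ncard_avoidingPerms_zero]

lemma innerCount_zero : innerCount 0 = 1 := by
  simp [innerCount, good_zero, not_upperPair_zero, not_invUpperPair_zero, ncard_avoidingPerms_zero]

lemma goodCount_succ (n : ℕ) : goodCount (n + 1) = ∑ p ∈ antidiagonal n,
    (if p.2 = 0 then goodCount p.1 else leftCount p.1) * rightCount p.2 := by
  rw [goodCount, ncard_avoidingPerms_succ n _
    (fun l r f => Good l f ∧ (0 < r → ¬ UpperPair l f))
    (fun _ r g => Good r g ∧ ¬ InvUpperPair r g)]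
  · refine Finset.sum_congr rfl fun p _ => ?_
    congr 1
    split_ifs with h
    · simp [goodCount, h]
    · simp [leftCount, Nat.pos_of_ne_zero h]
  · intro l r f g hf hg
    rw [good_skew_iff hf hg]
    rcases r with _ | r
    · simp [not_invUpperPair_zero]
    · simp

lemma leftCount_succ (n : ℕ) : leftCount (n + 1) = ∑ p ∈ antidiagonal n,
    leftCount p.1 * (if p.2 = 1 then 0 else innerCount p.2) := by
  rw [leftCount, ncard_avoidingPerms_succ n (fun n f => Good n f ∧ ¬ UpperPair n f)
    (fun l _ f => Good l f ∧ ¬ UpperPair l f)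
    (fun _ r g => r ≠ 1 ∧ Good r g ∧ ¬ UpperPair r g ∧ ¬ InvUpperPair r g)]
  · refine Finset.sum_congr rfl fun p _ => ?_
    congr 1
    split_ifs with h
    · simp [h]
    · simp [innerCount, h]
  · intro l r f g hf hg
    rw [good_skew_iff hf hg, upperPair_skew_iff hf hg]
    rcases r with _ | r
    · simp [not_invUpperPair_zero, not_upperPair_zero, good_zero]
    · simp
      tauto

lemma rightCount_succ (n : ℕ) : rightCount (n + 1) = ∑ p ∈ antidiagonal n,
    (if p.2 = 0 then rightCount p.1 else if p.1 = 0 then 0 else innerCount p.1) *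
      rightCount p.2 := by
  rw [rightCount, ncard_avoidingPerms_succ n (fun n f => Good n f ∧ ¬ InvUpperPair n f)
    (fun l r f => (0 < r → l ≠ 0) ∧ Good l f ∧ (0 < r → ¬ UpperPair l f) ∧ ¬ InvUpperPair l f)
    (fun _ r g => Good r g ∧ ¬ InvUpperPair r g)]
  · refine Finset.sum_congr rfl fun p _ => ?_
    congr 1
    split_ifs with h h'
    · simp [rightCount, h]
    · simp [h', Nat.pos_of_ne_zero h]
    · simp [innerCount, h', Nat.pos_of_ne_zero h]
  · intro l r f g hf hg
    rw [good_skew_iff hf hg, invUpperPair_skew_iff hf hg]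
    rcases r with _ | r
    · simp [not_invUpperPair_zero, good_zero]
    · simp
      tauto

lemma innerCount_succ (n : ℕ) : innerCount (n + 1) = ∑ p ∈ antidiagonal n,
    (if p.2 = 0 then innerCount p.1 else if p.1 = 0 then 0 else innerCount p.1) *
      (if p.2 = 1 then 0 else innerCount p.2) := by
  rw [innerCount, ncard_avoidingPerms_succ n
    (fun n f => Good n f ∧ ¬ UpperPair n f ∧ ¬ InvUpperPair n f)
    (fun l r f => (0 < r → l ≠ 0) ∧ Good l f ∧ ¬ UpperPair l f ∧ ¬ InvUpperPair l f)
    (fun _ r g => r ≠ 1 ∧ Good r g ∧ ¬ UpperPair r g ∧ ¬ InvUpperPair r g)]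
  · refine Finset.sum_congr rfl fun p _ => ?_
    congr 1
    · split_ifs with h h'
      · simp [innerCount, h]
      · simp [h', Nat.pos_of_ne_zero h]
      · simp [innerCount, h', Nat.pos_of_ne_zero h]
    · split_ifs with h
      · simp [h]
      · simp [innerCount, h]
  · intro l r f g hf hg
    rw [good_skew_iff hf hg, upperPair_skew_iff hf hg, invUpperPair_skew_iff hf hg]
    rcases r with _ | r
    · simp [not_invUpperPair_zero, not_upperPair_zero, good_zero]
    · simp
      tauto

lemma innerCount_one : innerCount 1 = 1 := by
  simp [innerCount_succ, innerCount_zero]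

lemma innerCount_succ_eq (n : ℕ) : innerCount (n + 1) = genCatalan n := by
  induction n using Nat.strong_induction_on with
  | _ n ih =>
    rcases n with _ | n
    · rw [innerCount_one, genCatalan]
    have hsum : innerCount (n + 2) = innerCount (n + 1) + ∑ p ∈ antidiagonal n,
        (if p.1 = 0 then 0 else innerCount p.1) *
          (if p.2 = 0 then 0 else innerCount (p.2 + 1)) := by
      rw [innerCount_succ, Finset.Nat.sum_antidiagonal_succ']
      simp [innerCount_zero]
    rw [hsum, ih n (by omega)]
    rcases n with _ | _ | n
    · simp [genCatalan]
    · rw [Finset.Nat.sum_antidiagonal_succ, genCatalan_add_two]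
      simp
    · rw [Finset.Nat.sum_antidiagonal_succ, Finset.Nat.sum_antidiagonal_succ',
        genCatalan_add_three']
      simp only [if_true, zero_mul, mul_zero, zero_add, Nat.succ_ne_zero, if_false]
      congr 1
      refine Finset.sum_congr rfl fun p hp => ?_
      have := mem_antidiagonal.1 hp
      rw [ih p.1 (by omega), ih (p.2 + 1) (by omega)]

lemma leftCount_eq (n : ℕ) : leftCount n = genCatalan n := by
  induction n using Nat.strong_induction_on with
  | _ n ih =>
    rcases n with _ | _ | n
    · rw [leftCount_zero, genCatalan]
    · simp [leftCount_succ, leftCount_zero, innerCount_zero, genCatalan]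
    have hsum : leftCount (n + 2) = leftCount (n + 1) + ∑ p ∈ antidiagonal n,
        leftCount p.1 * (if p.2 = 0 then 0 else innerCount (p.2 + 1)) := by
      rw [leftCount_succ, Finset.Nat.sum_antidiagonal_succ']
      simp [innerCount_zero]
    rw [hsum, ih (n + 1) (by omega)]
    rcases n with _ | n
    · simp [genCatalan]
    · rw [Finset.Nat.sum_antidiagonal_succ', genCatalan_add_three']
      simp only [if_true, mul_zero, zero_add, Nat.succ_ne_zero, if_false]
      congr 1
      refine Finset.sum_congr rfl fun p hp => ?_
      have := mem_antidiagonal.1 hp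
      rw [ih p.1 (by omega), innerCount_succ_eq]

lemma rightCount_eq (n : ℕ) : rightCount n = genCatalan n := by
  induction n using Nat.strong_induction_on with
  | _ n ih =>
    rcases n with _ | _ | n
    · rw [rightCount_zero, genCatalan]
    · simp [rightCount_succ, rightCount_zero, genCatalan]
    have hsum : rightCount (n + 2) = rightCount (n + 1) + ∑ p ∈ antidiagonal n,
        (if p.1 = 0 then 0 else innerCount p.1) * rightCount (p.2 + 1) := by
      rw [rightCount_succ, Finset.Nat.sum_antidiagonal_succ']
      simp [rightCount_zero]
    rw [hsum, ih (n + 1) (by omega)]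
    rcases n with _ | n
    · simp [genCatalan]
    · rw [Finset.Nat.sum_antidiagonal_succ, genCatalan_add_three']
      simp only [if_true, zero_mul, zero_add, Nat.succ_ne_zero, if_false]
      congr 1
      refine Finset.sum_congr rfl fun p hp => ?_
      have := mem_antidiagonal.1 hp
      rw [ih (p.2 + 1) (by omega), innerCount_succ_eq]

lemma goodCount_eq (n : ℕ) : goodCount n = genCatalan (n + 1) := by
  induction n with
  | zero => rw [goodCount_zero, genCatalan]
  | succ n ih =>
    rcases n with _ | n
    · simp [goodCount_succ, goodCount_zero, rightCount_zero, genCatalan]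
    · rw [goodCount_succ, Finset.Nat.sum_antidiagonal_succ', genCatalan_add_three']
      simp [leftCount_eq, rightCount_eq, ih, genCatalan.eq_1]

/-! ### From permutations of `Fin n` to functions on `ℕ` -/

/-- The one-line notation of a permutation of `Fin n`, extended by zero. -/
def extend {n : ℕ} (σ : Equiv.Perm (Fin n)) : ℕ → ℕ := fun i => if h : i < n then σ ⟨i, h⟩ else 0

lemma extend_apply {n : ℕ} (σ : Equiv.Perm (Fin n)) {i : ℕ} (h : i < n) :
    extend σ i = σ ⟨i, h⟩ := dif_pos h

lemma extend_coe {n : ℕ} (σ : Equiv.Perm (Fin n)) (i : Fin n) : extend σ i = σ i :=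
  extend_apply σ i.2

lemma extend_injective {n : ℕ} : Function.Injective (extend (n := n)) := by
  intro σ τ h
  ext i
  rw [← extend_coe, ← extend_coe, h]

lemma extend_mem_iff {n : ℕ} (σ : Equiv.Perm (Fin n)) :
    extend σ ∈ AvoidingPerms n ↔ ¬ Has132 σ := by
  constructor
  · rintro ⟨-, -, -, h⟩ ⟨i, j, k, hij, hjk, h1, h2⟩
    refine h i j k hij hjk k.2 ?_ ?_
    · rw [extend_coe, extend_coe]; exact h1
    · rw [extend_coe, extend_coe]; exact h2
  · intro h
    refine ⟨fun i hi => ?_, fun i hi j hj hij => ?_, fun i hi => ?_,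
      fun i j k hij hjk hk h1 h2 => ?_⟩
    · rw [extend_apply σ hi]; exact (σ _).2
    · rw [extend_apply σ hi, extend_apply σ hj] at hij
      simpa using σ.injective (Fin.ext hij)
    · simp [extend, not_lt.2 hi]
    · rw [extend_apply σ hk, extend_apply σ (by omega : i < n)] at h1
      rw [extend_apply σ hk, extend_apply σ (by omega : j < n)] at h2
      exact h ⟨_, _, _, hij, hjk, h1, h2⟩

lemma exists_extend_eq {n : ℕ} {f : ℕ → ℕ} (hf : f ∈ AvoidingPerms n) :
    ∃ σ : Equiv.Perm (Fin n), extend σ = f := by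
  obtain ⟨f1, f2, f3, -⟩ := hf
  let e : Fin n → Fin n := fun i => ⟨f i, f1 i i.2⟩
  have he : Function.Injective e := fun i j h =>
    Fin.ext (f2 i i.2 j j.2 (congrArg Fin.val h))
  refine ⟨Equiv.ofBijective e (Finite.injective_iff_bijective.1 he), funext fun i => ?_⟩
  by_cases hi : i < n
  · rw [extend_apply _ hi]; rfl
  · rw [f3 i (by omega), extend, dif_neg hi]

lemma upperTriple_extend_iff {n : ℕ} (σ : Equiv.Perm (Fin n)) :
    UpperTriple n (extend σ) ↔ HasUpperTriple σ := by
  constructor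
  · rintro ⟨i, j, k, hij, hjk, hk, hkj, hji, hm⟩
    have hj := hjk.trans hk
    have hi := hij.trans hj
    rw [extend_apply σ hk, extend_apply σ hj] at hkj
    rw [extend_apply σ hj, extend_apply σ hi] at hji
    refine ⟨⟨i, hi⟩, ⟨j, hj⟩, ⟨k, hk⟩, hij, hjk, hkj, hji, fun m him hmk hne => ?_⟩
    have := hm m him hmk (fun h => hne (Fin.ext h))
    rwa [extend_coe, extend_apply σ hi] at this
  · rintro ⟨i, j, k, hij, hjk, hkj, hji, hm⟩
    refine ⟨i, j, k, hij, hjk, k.2, ?_, ?_, fun m him hmk hne => ?_⟩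
    · simpa [extend_coe] using hkj
    · simpa [extend_coe] using hji
    · have hmn : m < n := hmk.trans k.2
      rw [extend_coe, extend_apply σ hmn]
      exact hm ⟨m, hmn⟩ him hmk (fun h => hne (congrArg Fin.val h))

lemma invUpperTriple_extend_iff {n : ℕ} (σ : Equiv.Perm (Fin n)) :
    InvUpperTriple n (extend σ) ↔ HasUpperTriple σ⁻¹ := by
  rw [hasUpperTriple_inv_iff]
  constructor
  · rintro ⟨i, j, k, hij, hjk, hk, hkj, hji, hm⟩
    have hj := hjk.trans hk
    have hi := hij.trans hj
    rw [extend_apply σ hk, extend_apply σ hj] at hkj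
    rw [extend_apply σ hj, extend_apply σ hi] at hji
    refine ⟨⟨i, hi⟩, ⟨j, hj⟩, ⟨k, hk⟩, hij, hjk, hkj, hji, fun m h1 h2 hne => ?_⟩
    refine hm m m.2 ?_ ?_ (fun h => hne (Fin.ext h))
    · rw [extend_coe, extend_apply σ hk]; exact h1
    · rw [extend_coe, extend_apply σ hi]; exact h2
  · rintro ⟨i, j, k, hij, hjk, hkj, hji, hm⟩
    refine ⟨i, j, k, hij, hjk, k.2, ?_, ?_, fun m hmn h1 h2 hne => ?_⟩
    · simpa [extend_coe] using hkj
    · simpa [extend_coe] using hji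
    · rw [extend_coe, extend_apply σ hmn] at h1 h2
      exact hm ⟨m, hmn⟩ h1 h2 (fun h => hne (congrArg Fin.val h))

lemma extend_image_DRS (n : ℕ) :
    extend '' DRS n ![1, 3, 2] = {f ∈ AvoidingPerms n | Good n f} := by
  have h : ∀ σ : Equiv.Perm (Fin n), σ ∈ DRS n ![1, 3, 2] ↔
      extend σ ∈ AvoidingPerms n ∧ Good n (extend σ) := fun σ => by
    rw [extend_mem_iff, Good, upperTriple_extend_iff, invUpperTriple_extend_iff, DRS,
      Set.mem_ofPred_eq, IsDoubleSimsun, isSimsun_iff, isSimsun_iff, containsPattern_132_iff,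
      and_comm]
  ext f
  constructor
  · rintro ⟨σ, hσ, rfl⟩
    exact (h σ).1 hσ
  · intro hf
    obtain ⟨σ, rfl⟩ := exists_extend_eq hf.1
    exact ⟨σ, (h σ).2 hf, rfl⟩

lemma ncard_DRS (n : ℕ) : (DRS n ![1, 3, 2]).ncard = genCatalan (n + 1) := by
  rw [← Set.ncard_image_of_injective _ extend_injective, extend_image_DRS,
    ← goodCount_eq, goodCount]

end Simsun

theorem mainTheorem5 (n : ℕ) :
    (Simsun.DRS n ![1, 3, 2]).ncard = Simsun.secondaryStructureNumber n ∧
    Simsun.secondaryStructureNumber n = (Simsun.UUFreeMotzkinPaths n).ncard ∧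
    Function.Involutive (Simsun.Gam (n := n)) ∧
    Set.BijOn Simsun.Gam (Simsun.DRS n ![1, 3, 2]) (Simsun.DRS n ![2, 1, 3]) :=
  ⟨Simsun.ncard_DRS n, (Simsun.ncard_paths n).1.symm, Simsun.gam_gam, Simsun.gam_bijOn n⟩
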